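/- Let $n\ge 1$ be an integer, $s>0$ a real number and $\Omega\subset\mathbb{R}^n$ a bounded domain (nonempty, open, connected) of volume $|\Omega|$, and let $\omega_n$ be the volume of the unit ball of $\mathbb{R}^n$. Write $\widehat u(\xi)=(2\pi)^{-n/2}\int_{\mathbb{R}^n}u(x)e^{-ix\cdot\xi}\,dx$ for the Fourier transform on $L^2(\mathbb{R}^n;\mathbb{C})$, let $H^{s+\ln}(\mathbb{R}^n)$ be the space of all $u\in L^2(\mathbb{R}^n;\mathbb{C})$ with $\int_{\mathbb{R}^n}|\xi|^{2s}\,\bigl|\ln|\xi|^2\bigr|\,|\widehat u(\xi)|^2\,d\xi<\infty$, with squared norm $\|u\|_{L^2}^2+\int_{\mathbb{R}^n}|\xi|^{2s}\bigl|\ln|\xi|^2\bigr||\widehat u(\xi)|^2\,d\xi$. Let $\mathcal{H}_0^{s+\ln}(\Omega)$ be either the space of all $u\in H^{s+\ln}(\mathbb{R}^n)$ with $u=0$ almost everywhere outside $\Omega$, or the closure of $C_c^\infty(\Omega)$ in $H^{s+\ln}(\mathbb{R}^n)$; the result holds for both choices. A real number $\mu$ is a Dirichlet eigenvalue of $(-\Delta)^{s+\ln}$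 on $\Omega$, the operator with symbol $|\xi|^{2s}\ln|\xi|^2$, if its eigenspace $$\Bigl\{u\in\mathcal{H}_0^{s+\ln}(\Omega):\ \int_{\mathbb{R}^n}|\xi|^{2s}\ln|\xi|^2\,\widehat u(\xi)\,\overline{\widehat v(\xi)}\,d\xi=\mu\int_\Omega u\,\overline v\,dx\ \text{ for all } v\in\mathcal{H}_0^{s+\ln}(\Omega)\Bigr\}$$ is nonzero, and its multiplicity is the dimension of this space. Let $\lambda_1\le\lambda_2\le\cdots$ be the sequence of all Dirichlet eigenvalues of $(-\Delta)^{s+\ln}$ on $\Omega$, in nondecreasing order and repeated according to multiplicity. Then, for every integer $k\ge 1$, $$\sum_{j=1}^{k}\lambda_j\ \ge\ -(2\pi)^{-n}\,\frac{2n\,\omega_n}{(n+2s)^2}\,|\Omega| ,$$ and if moreover $k\ge(2\pi)^{-n}\omega_n|\Omega|$, then $$\sum_{j=1}^{k}\lambda_j\ \ge\ \frac{2}{n+2s}\,(2\pi)^{2s}\,(\omega_n|\Omega|)^{-2s/n}\,k^{1+2s/n}\left(\ln\frac{(2\pi)^n k}{\omega_n|\Omega|}-\frac{n}{n+2s}\right).$$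 -/

import Mathlib

open MeasureTheory
open scoped FourierTransform ContDiff

noncomputable section

namespace FracLog

/-- The space `L²(ℝⁿ)` of complex-valued functions. -/
abbrev L2 (n : ℕ) : Type :=
  Lp ℂ 2 (volume : Measure (EuclideanSpace ℝ (Fin n)))

/-- The Fourier transform `û(ξ) = (2π)^{-n/2} ∫ u(x) e^{-i x·ξ} dx` of `u ∈ L²(ℝⁿ)` (in the sense of
Plancherel), as a function of `ξ`. It is obtained by rescaling Mathlib's transform
`𝓕 u (η) = ∫ u(x) e^{-2πi x·η} dx`. -/
def hat {n : ℕ} (u : L2 n) (ξ : EuclideanSpace ℝ (Fin n)) : ℂ :=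
  (((2 * Real.pi) ^ (-(n : ℝ) / 2) : ℝ) : ℂ) * (𝓕 u : L2 n) ((2 * Real.pi)⁻¹ • ξ)

/-- The symbol `|ξ|^{2s} ln |ξ|²` of the operator `(-Δ)^{s+ln}`. -/
def symbol {n : ℕ} (s : ℝ) (ξ : EuclideanSpace ℝ (Fin n)) : ℝ :=
  ‖ξ‖ ^ (2 * s) * Real.log (‖ξ‖ ^ 2)

theorem measurable_symbol {n : ℕ} (s : ℝ) :
    Measurable (symbol s : EuclideanSpace ℝ (Fin n) → ℝ) := by
  unfold symbol
  fun_prop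

theorem qmp_smul (n : ℕ) :
    Measure.QuasiMeasurePreserving
      (fun ξ : EuclideanSpace ℝ (Fin n) => (2 * Real.pi)⁻¹ • ξ) volume volume := by
  have hc : ((2 * Real.pi)⁻¹ : ℝ) ≠ 0 := by positivity
  refine ⟨by fun_prop, ?_⟩
  rw [Measure.map_addHaar_smul _ hc]
  exact Measure.smul_absolutelyContinuous

theorem aestronglyMeasurable_hat {n : ℕ} (u : L2 n) : AEStronglyMeasurable (hat u) volume := by
  unfold hat
  exact ((Lp.aestronglyMeasurable (𝓕 u : L2 n)).comp_quasiMeasurePreserving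
    (qmp_smul n)).const_mul _

theorem hat_add {n : ℕ} (u v : L2 n) :
    hat (u + v) =ᵐ[volume] fun ξ => hat u ξ + hat v ξ := by
  have h := (qmp_smul n).ae (Lp.coeFn_add (𝓕 u : L2 n) (𝓕 v : L2 n))
  filter_upwards [h] with ξ hξ
  simp only [hat, FourierTransform.fourier_add]
  rw [hξ]
  simp [mul_add]

theorem hat_smul {n : ℕ} (c : ℂ) (u : L2 n) :
    hat (c • u) =ᵐ[volume] fun ξ => c * hat u ξ := by
  have h := (qmp_smul n).ae (Lp.coeFn_smul c (𝓕 u : L2 n))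
  filter_upwards [h] with ξ hξ
  simp only [hat, FourierTransform.fourier_smul]
  rw [hξ]
  simp
  ring

theorem hat_zero (n : ℕ) : hat (0 : L2 n) =ᵐ[volume] fun _ => 0 := by
  have h := hat_smul (0 : ℂ) (0 : L2 n)
  simpa using h

/-- The space `H^{s+ln}(ℝⁿ)`: all `u ∈ L²(ℝⁿ)` with `∫ |ξ|^{2s} |ln |ξ|²| |û(ξ)|² dξ < ∞`. -/
def energySpace (n : ℕ) (s : ℝ) : Submodule ℂ (L2 n) where
  carrier := {u | Integrable (fun ξ => |symbol s ξ| * ‖hat u ξ‖ ^ 2) volume}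
  zero_mem' := by
    refine (integrable_zero _ ℝ volume).congr ?_
    filter_upwards [hat_zero n] with ξ hξ
    simp [hξ]
  add_mem' := by
    intro u v hu hv
    refine ((hu.add hv).const_mul 2).mono' ?_ ?_
    · exact ((measurable_symbol s).abs.aestronglyMeasurable).mul
        ((aestronglyMeasurable_hat _).norm.pow 2)
    · filter_upwards [hat_add u v] with ξ hξ
      rw [hξ, Real.norm_of_nonneg (by positivity)]
      have h1 : ‖hat u ξ + hat v ξ‖ ^ 2 ≤ 2 * (‖hat u ξ‖ ^ 2 + ‖hat v ξ‖ ^ 2) := by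
        have := norm_add_le (hat u ξ) (hat v ξ)
        nlinarith [sq_nonneg (‖hat u ξ‖ - ‖hat v ξ‖), norm_nonneg (hat u ξ + hat v ξ)]
      have h2 := mul_le_mul_of_nonneg_left h1 (abs_nonneg (symbol s ξ))
      simp only [Pi.add_apply]
      linarith
  smul_mem' := by
    intro c u hu
    refine (Integrable.const_mul hu (‖c‖ ^ 2)).congr ?_
    filter_upwards [hat_smul c u] with ξ hξ
    rw [hξ, norm_mul]
    ring

/-- The squared norm `‖u‖²_{L²} + ∫ |ξ|^{2s} |ln |ξ|²| |û(ξ)|² dξ` of `H^{s+ln}(ℝⁿ)`. -/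
def energyNormSq {n : ℕ} {s : ℝ} (u : energySpace n s) : ℝ :=
  ‖(u : L2 n)‖ ^ 2 + ∫ ξ, |symbol s ξ| * ‖hat (u : L2 n) ξ‖ ^ 2

/-- The quadratic form `∫ |ξ|^{2s} ln |ξ|² û(ξ) conj (v̂(ξ)) dξ` of `(-Δ)^{s+ln}`; the integral
converges absolutely on `H^{s+ln}(ℝⁿ)`. -/
def form {n : ℕ} {s : ℝ} (u v : energySpace n s) : ℂ :=
  ∫ ξ, (symbol s ξ : ℂ) * (hat (u : L2 n) ξ * star (hat (v : L2 n) ξ))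

theorem integrable_form {n : ℕ} {s : ℝ} (u v : energySpace n s) :
    Integrable (fun ξ => (symbol s ξ : ℂ) * (hat (u : L2 n) ξ * star (hat (v : L2 n) ξ)))
      volume := by
  have hu : Integrable (fun ξ => |symbol s ξ| * ‖hat (u : L2 n) ξ‖ ^ 2) volume := u.2
  have hv : Integrable (fun ξ => |symbol s ξ| * ‖hat (v : L2 n) ξ‖ ^ 2) volume := v.2
  refine (hu.add hv).mono' ?_ (Filter.Eventually.of_forall fun ξ => ?_)
  · exact (Complex.measurable_ofReal.comp (measurable_symbol s)).aestronglyMeasurable.mul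
      ((aestronglyMeasurable_hat _).mul
        (continuous_star.comp_aestronglyMeasurable (aestronglyMeasurable_hat _)))
  · have h1 : ‖hat (u : L2 n) ξ‖ * ‖hat (v : L2 n) ξ‖ ≤
        ‖hat (u : L2 n) ξ‖ ^ 2 + ‖hat (v : L2 n) ξ‖ ^ 2 := by
      nlinarith [sq_nonneg (‖hat (u : L2 n) ξ‖ - ‖hat (v : L2 n) ξ‖),
        sq_nonneg ‖hat (u : L2 n) ξ‖, sq_nonneg ‖hat (v : L2 n) ξ‖]
    have h2 := mul_le_mul_of_nonneg_left h1 (abs_nonneg (symbol s ξ))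
    simp only [Pi.add_apply, norm_mul, norm_star, Complex.norm_real, Real.norm_eq_abs]
    linarith

theorem form_add_left {n : ℕ} {s : ℝ} (u v w : energySpace n s) :
    form (u + v) w = form u w + form v w := by
  unfold form
  rw [← integral_add (integrable_form u w) (integrable_form v w)]
  refine integral_congr_ae ?_
  filter_upwards [hat_add (u : L2 n) (v : L2 n)] with ξ hξ
  simp only [Submodule.coe_add, hξ]
  ring

theorem form_smul_left {n : ℕ} {s : ℝ} (c : ℂ) (u w : energySpace n s) :
    form (c • u) w = c * form u w := by
  unfold form
  rw [← integral_const_mul]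
  refine integral_congr_ae ?_
  filter_upwards [hat_smul c (u : L2 n)] with ξ hξ
  simp only [Submodule.coe_smul, hξ]
  ring

theorem energyNormSq_zero (n : ℕ) (s : ℝ) : energyNormSq (0 : energySpace n s) = 0 := by
  have : ∫ ξ, |symbol s ξ| * ‖hat (0 : L2 n) ξ‖ ^ 2 = 0 := by
    rw [← integral_zero (EuclideanSpace ℝ (Fin n)) ℝ]
    refine integral_congr_ae ?_
    filter_upwards [hat_zero n] with ξ hξ
    simp [hξ]
  simp [energyNormSq, this]

theorem energyNormSq_smul {n : ℕ} {s : ℝ} (c : ℂ) (u : energySpace n s) :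
    energyNormSq (c • u) = ‖c‖ ^ 2 * energyNormSq u := by
  unfold energyNormSq
  rw [mul_add, ← integral_const_mul]
  congr 1
  · simp [norm_smul, mul_pow]
  · refine integral_congr_ae ?_
    filter_upwards [hat_smul c (u : L2 n)] with ξ hξ
    simp only [Submodule.coe_smul, hξ, norm_mul]
    ring

theorem energyNormSq_add_le {n : ℕ} {s : ℝ} (u v : energySpace n s) :
    energyNormSq (u + v) ≤ 2 * (energyNormSq u + energyNormSq v) := by
  have hu : Integrable (fun ξ => |symbol s ξ| * ‖hat (u : L2 n) ξ‖ ^ 2) volume := u.2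
  have hv : Integrable (fun ξ => |symbol s ξ| * ‖hat (v : L2 n) ξ‖ ^ 2) volume := v.2
  have huv : Integrable (fun ξ => |symbol s ξ| * ‖hat ((u + v : energySpace n s) : L2 n) ξ‖ ^ 2)
      volume := (u + v).2
  have key : ∀ a b c : ℝ, 0 ≤ c → c ≤ a + b → c ^ 2 ≤ 2 * (a ^ 2 + b ^ 2) := by
    intro a b c h0 h
    nlinarith [sq_nonneg (a - b)]
  have h1 : ‖((u + v : energySpace n s) : L2 n)‖ ^ 2 ≤
      2 * (‖(u : L2 n)‖ ^ 2 + ‖(v : L2 n)‖ ^ 2) :=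
    key _ _ _ (norm_nonneg _) (norm_add_le (u : L2 n) (v : L2 n))
  have h2 : ∫ ξ, |symbol s ξ| * ‖hat ((u + v : energySpace n s) : L2 n) ξ‖ ^ 2 ≤
      2 * ((∫ ξ, |symbol s ξ| * ‖hat (u : L2 n) ξ‖ ^ 2) +
        ∫ ξ, |symbol s ξ| * ‖hat (v : L2 n) ξ‖ ^ 2) := by
    rw [← integral_add hu hv, ← integral_const_mul]
    refine integral_mono_ae huv ((hu.add hv).const_mul 2) ?_
    filter_upwards [hat_add (u : L2 n) (v : L2 n)] with ξ hξ
    have h3 := mul_le_mul_of_nonneg_left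
      (key _ _ _ (norm_nonneg _) (norm_add_le (hat (u : L2 n) ξ) (hat (v : L2 n) ξ)))
      (abs_nonneg (symbol s ξ))
    simp only [Submodule.coe_add, hξ]
    linarith
  unfold energyNormSq
  linarith

/-- The functions of `H^{s+ln}(ℝⁿ)` that vanish almost everywhere outside `Ω`. -/
def vanishingSpace {n : ℕ} (s : ℝ) (Ω : Set (EuclideanSpace ℝ (Fin n))) :
    Submodule ℂ (energySpace n s) where
  carrier := {u | ∀ᵐ x ∂(volume : Measure (EuclideanSpace ℝ (Fin n))), x ∉ Ω → (u : L2 n) x = 0}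
  zero_mem' := by
    filter_upwards [Lp.coeFn_zero ℂ 2 (volume : Measure (EuclideanSpace ℝ (Fin n)))] with x hx _
    simpa only [Submodule.coe_zero, Pi.zero_apply] using hx
  add_mem' := by
    intro u v hu hv
    filter_upwards [hu, hv, Lp.coeFn_add (u : L2 n) (v : L2 n)] with x h1 h2 h3 hx
    rw [Submodule.coe_add, h3, Pi.add_apply, h1 hx, h2 hx, add_zero]
  smul_mem' := by
    intro c u hu
    filter_upwards [hu, Lp.coeFn_smul c (u : L2 n)] with x h1 h2 hx
    rw [Submodule.coe_smul, h2, Pi.smul_apply, h1 hx, smul_zero]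

/-- The closure of `C_c^∞(Ω)` in the norm of `H^{s+ln}(ℝⁿ)`, inside the functions that vanish
almost everywhere outside `Ω`. -/
def testClosure {n : ℕ} (s : ℝ) (Ω : Set (EuclideanSpace ℝ (Fin n))) :
    Submodule ℂ (energySpace n s) where
  carrier := {u | u ∈ vanishingSpace s Ω ∧ ∀ ε : ℝ, 0 < ε →
    ∃ φ : EuclideanSpace ℝ (Fin n) → ℂ,
      ContDiff ℝ ∞ φ ∧ HasCompactSupport φ ∧ tsupport φ ⊆ Ω ∧
      ∃ v : energySpace n s, (v : L2 n) =ᵐ[volume] φ ∧ energyNormSq (u - v) < ε}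
  zero_mem' := by
    refine ⟨Submodule.zero_mem _, fun ε hε => ⟨0, contDiff_const, HasCompactSupport.zero, ?_, 0,
      Lp.coeFn_zero ℂ 2 volume, ?_⟩⟩
    · simp [tsupport]
    · simpa [energyNormSq_zero] using hε
  add_mem' := by
    rintro u v ⟨hu, hu'⟩ ⟨hv, hv'⟩
    refine ⟨Submodule.add_mem _ hu hv, fun ε hε => ?_⟩
    obtain ⟨φ, h1, h2, h3, a, h4, h5⟩ := hu' (ε / 4) (by positivity)
    obtain ⟨ψ, g1, g2, g3, b, g4, g5⟩ := hv' (ε / 4) (by positivity)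
    refine ⟨φ + ψ, h1.add g1, h2.add g2,
      (tsupport_add φ ψ).trans (Set.union_subset h3 g3), a + b, ?_, ?_⟩
    · exact (Lp.coeFn_add (a : L2 n) (b : L2 n)).trans (h4.add g4)
    · have h := energyNormSq_add_le (u - a) (v - b)
      rw [show u + v - (a + b) = (u - a) + (v - b) by abel]
      linarith
  smul_mem' := by
    rintro c u ⟨hu, hu'⟩
    refine ⟨Submodule.smul_mem _ c hu, fun ε hε => ?_⟩
    obtain ⟨φ, h1, h2, h3, a, h4, h5⟩ := hu' (ε / (‖c‖ ^ 2 + 1)) (by positivity)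
    refine ⟨c • φ, h1.const_smul c, h2.smul_left, ?_, c • a, ?_, ?_⟩
    · exact (tsupport_smul_subset_right (fun _ => c) φ).trans h3
    · exact (Lp.coeFn_smul c (a : L2 n)).trans (h4.const_smul c)
    · rw [← smul_sub, energyNormSq_smul]
      rw [lt_div_iff₀ (by positivity)] at h5
      have h0 : 0 ≤ energyNormSq (u - a) := by
        unfold energyNormSq
        have : 0 ≤ ∫ ξ, |symbol s ξ| * ‖hat ((u - a : energySpace n s) : L2 n) ξ‖ ^ 2 :=
          integral_nonneg fun ξ => by positivity
        positivity
      nlinarith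

/-- The (weak) Dirichlet eigenspace of `(-Δ)^{s+ln}` for the value `μ` and the form domain `V`: all
`u ∈ V` with `∫ |ξ|^{2s} ln |ξ|² û conj v̂ dξ = μ ∫ u conj v dx` for every `v ∈ V`. -/
def eigenspace {n : ℕ} {s : ℝ} (V : Submodule ℂ (energySpace n s)) (μ : ℝ) :
    Submodule ℂ (energySpace n s) where
  carrier := {u | u ∈ V ∧ ∀ v ∈ V, form u v = (μ : ℂ) * inner ℂ (v : L2 n) (u : L2 n)}
  zero_mem' := by
    refine ⟨Submodule.zero_mem _, fun v _ => ?_⟩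
    have h := form_smul_left (0 : ℂ) 0 v
    simpa using h
  add_mem' := by
    rintro u v ⟨hu, hu'⟩ ⟨hv, hv'⟩
    refine ⟨Submodule.add_mem _ hu hv, fun w hw => ?_⟩
    rw [form_add_left, hu' w hw, hv' w hw, Submodule.coe_add, inner_add_right]
    ring
  smul_mem' := by
    rintro c u ⟨hu, hu'⟩
    refine ⟨Submodule.smul_mem _ c hu, fun w hw => ?_⟩
    rw [form_smul_left, hu' w hw, Submodule.coe_smul, inner_smul_right]
    ring

/-- `lam 0 ≤ lam 1 ≤ …` is the list `λ₁ ≤ λ₂ ≤ …` (so `lam j = λ_{j+1}`) of all eigenvalues of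
`(-Δ)^{s+ln}` with form domain `V`, in nondecreasing order and repeated according to their
multiplicity: every real `μ` occurs in it exactly as often as the dimension of its eigenspace
(in particular not at all if `μ` is no eigenvalue). -/
structure IsEigenvalueSequence {n : ℕ} {s : ℝ} (V : Submodule ℂ (energySpace n s))
    (lam : ℕ → ℝ) : Prop where
  monotone : Monotone lam
  multiplicity : ∀ μ : ℝ,
    {j : ℕ | lam j = μ}.encard = Cardinal.toENat (Module.rank ℂ (eigenspace V μ))

/-- The volume `ω_n` of the unit ball of `ℝⁿ`. -/
def unitBallVolume (n : ℕ) : ℝ :=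
  volume.real (Metric.ball (0 : EuclideanSpace ℝ (Fin n)) 1)

end FracLog

end

/-! ### Fourier side: Plancherel and a pointwise bound on the spectral density -/

namespace FracLog

/-! This is the Berezin–Li–Yau argument. For L²-orthonormal eigenfunctions `u j`, put `F ξ = ∑ j,
‖hat (u j) ξ‖ ^ 2`. Plancherel gives `∫ F = k`, and testing each eigenvalue equation against `u j`
itself gives `∫ symbol s * F = ∑ λ_j`. Bessel's inequality for the plane waves cut off to `Ω` gives
`0 ≤ F ≤ M := (2π)^{-n} |Ω|` almost everywhere (`sum_norm_hat_sq_le`).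

It remains to bound `∫ symbol s * F` below under these constraints. By the bathtub principle
(`bathtub_le_integral_mul`) the optimal `F` is `M` on a sublevel set of the symbol and `0`
elsewhere. The symbol is not monotone in `‖ξ‖` near the origin, but it is nonpositive on the unit
ball and increasing outside, so every ball of radius `R ≥ 1` works. This yields one inequality for
each `R ≥ 1` (`sum_eigenvalues_ge`). At `R = 1` the level is `0`, the mass `k` drops out and the
first bound results. The radius with `M ω_n R^n = k` gives the second bound, and the condition on
`k` says exactly that this radius is at least `1`. -/

theorem fourier_ae_eq {n : ℕ} (u : L2 n) (hu : Integrable u volume) :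
    ((𝓕 u : L2 n) : EuclideanSpace ℝ (Fin n) → ℂ) =ᵐ[volume]
      𝓕 (u : EuclideanSpace ℝ (Fin n) → ℂ) := by
  have hcont : Continuous (𝓕 (u : EuclideanSpace ℝ (Fin n) → ℂ)) :=
    VectorFourier.fourierIntegral_continuous Real.continuous_fourierChar
      continuous_inner hu
  -- Both sides have the same integrals against test functions: the L² transform by duality of
  -- tempered distributions (`h1`), the Fourier integral by Fubini (`h2`).
  refine ae_eq_of_integral_contDiff_smul_eq
    ((Lp.memLp (𝓕 u : L2 n)).locallyIntegrable (by norm_num)) hcont.locallyIntegrable ?_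
  intro g hg hgc
  have hc : HasCompactSupport (fun x => (g x : ℂ)) := hgc.comp_left Complex.ofReal_zero
  let G : SchwartzMap (EuclideanSpace ℝ (Fin n)) ℂ :=
    hc.toSchwartzMap (Complex.ofRealCLM.contDiff.comp hg)
  have hG : ∀ x, G x = (g x : ℂ) := fun x => rfl
  have h1 := congrArg (fun T => T G) (Lp.fourier_toTemperedDistribution_eq u)
  simp only [TemperedDistribution.fourier_apply, Lp.toTemperedDistribution_apply] at h1
  have h2 := VectorFourier.integral_fourierIntegral_smul_eq_flip
    (μ := (volume : Measure (EuclideanSpace ℝ (Fin n)))) (ν := volume)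
    (L := innerₗ (EuclideanSpace ℝ (Fin n))) (f := G) (g := u)
    Real.continuous_fourierChar continuous_inner G.integrable hu
  rw [flip_innerₗ] at h2
  calc ∫ x, g x • (𝓕 u : L2 n) x = ∫ x, G x • (𝓕 u : L2 n) x := by
        simp [hG]
    _ = ∫ x, (𝓕 G) x • u x := h1.symm
    _ = ∫ x, G x • 𝓕 (u : EuclideanSpace ℝ (Fin n) → ℂ) x := h2
    _ = _ := by simp [hG]

theorem integrable_of_vanishing {n : ℕ} {Ω : Set (EuclideanSpace ℝ (Fin n))}
    (hΩ : MeasurableSet Ω) (hfin : volume Ω ≠ ⊤) (u : L2 n)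
    (hu : ∀ᵐ x ∂(volume : Measure (EuclideanSpace ℝ (Fin n))), x ∉ Ω → u x = 0) :
    Integrable u volume := by
  have : IsFiniteMeasure (volume.restrict Ω) := ⟨by simpa using hfin.lt_top⟩
  have h1 : IntegrableOn u Ω volume := ((Lp.memLp u).restrict Ω).integrable (by norm_num)
  refine (integrable_indicator_iff hΩ |>.2 h1).congr ?_
  filter_upwards [hu] with x hx
  by_cases h : x ∈ Ω
  · simp [h]
  · simp [h, hx h]

/-- The Fourier integral of `u j` at `η` is its inner product with the plane wave of frequency `η`
cut off to `Ω`. This wave has squared norm `|Ω|`, so Bessel's inequality applies. -/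
theorem sum_norm_fourier_sq_le {n : ℕ} {Ω : Set (EuclideanSpace ℝ (Fin n))}
    (hΩ : MeasurableSet Ω) (hfin : volume Ω ≠ ⊤) {ι : Type*} [Fintype ι] (u : ι → L2 n)
    (hu : ∀ j, ∀ᵐ x ∂(volume : Measure (EuclideanSpace ℝ (Fin n))), x ∉ Ω → u j x = 0)
    (hon : Orthonormal ℂ u) (η : EuclideanSpace ℝ (Fin n)) :
    ∑ j, ‖𝓕 (u j : EuclideanSpace ℝ (Fin n) → ℂ) η‖ ^ 2 ≤ volume.real Ω := by
  set e : EuclideanSpace ℝ (Fin n) → ℂ :=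
    Ω.indicator fun x => ((Real.fourierChar (inner ℝ x η) : Circle) : ℂ) with he
  have hmeas : AEStronglyMeasurable e volume := by
    refine AEStronglyMeasurable.indicator ?_ hΩ
    have : Continuous fun x : EuclideanSpace ℝ (Fin n) =>
        ((Real.fourierChar (inner ℝ x η) : Circle) : ℂ) := by
      have := Real.continuous_fourierChar
      fun_prop
    exact this.aestronglyMeasurable
  have hnorm : ∀ x, ‖e x‖ = ‖Ω.indicator (fun _ => (1 : ℂ)) x‖ := by
    intro x
    by_cases h : x ∈ Ω
    · simp [he, h, Circle.norm_coe]
    · simp [he, h]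
  have hmem : MemLp e 2 volume :=
    (memLp_indicator_const 2 hΩ (1 : ℂ) (Or.inr hfin)).congr_norm hmeas
      (Filter.Eventually.of_forall fun x => (hnorm x).symm)
  have hsq : ‖hmem.toLp e‖ ^ 2 = volume.real Ω := by
    have h1 : ‖hmem.toLp e‖ = ‖indicatorConstLp 2 hΩ hfin (1 : ℂ)‖ := by
      rw [Lp.norm_def, Lp.norm_def, eLpNorm_congr_ae hmem.coeFn_toLp,
        eLpNorm_congr_ae indicatorConstLp_coeFn]
      congr 1
      exact eLpNorm_congr_norm_ae (Filter.Eventually.of_forall hnorm)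
    rw [h1, norm_indicatorConstLp (by norm_num) (by norm_num)]
    simp only [norm_one, one_mul, ENNReal.toReal_ofNat]
    rw [← Real.sqrt_eq_rpow, Real.sq_sqrt measureReal_nonneg]
  have hinner : ∀ j, ‖𝓕 (u j : EuclideanSpace ℝ (Fin n) → ℂ) η‖ =
      ‖inner ℂ (u j) (hmem.toLp e)‖ := by
    intro j
    rw [norm_inner_symm, L2.inner_def, Real.fourier_eq]
    congr 1
    refine integral_congr_ae ?_
    filter_upwards [hu j, hmem.coeFn_toLp] with x h1 h2
    rw [h2]
    by_cases h : x ∈ Ω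
    · simp [he, h, Circle.smul_def, mul_comm]
    · simp [h1 h]
  calc _ = ∑ j, ‖inner ℂ (u j) (hmem.toLp e)‖ ^ 2 := by simp [hinner]
    _ ≤ ‖hmem.toLp e‖ ^ 2 := hon.sum_inner_products_le _
    _ = _ := hsq

theorem sum_norm_hat_sq_le {n : ℕ} {Ω : Set (EuclideanSpace ℝ (Fin n))}
    (hΩ : MeasurableSet Ω) (hfin : volume Ω ≠ ⊤) {ι : Type*} [Fintype ι] (u : ι → L2 n)
    (hu : ∀ j, ∀ᵐ x ∂(volume : Measure (EuclideanSpace ℝ (Fin n))), x ∉ Ω → u j x = 0)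
    (hon : Orthonormal ℂ u) :
    ∀ᵐ ξ ∂(volume : Measure (EuclideanSpace ℝ (Fin n))),
      ∑ j, ‖hat (u j) ξ‖ ^ 2 ≤ (2 * Real.pi) ^ (-(n : ℝ)) * volume.real Ω := by
  have h := fun j => (qmp_smul n).ae
    (fourier_ae_eq (u j) (integrable_of_vanishing hΩ hfin (u j) (hu j)))
  filter_upwards [ae_all_iff.2 h] with ξ hξ
  have hc : ((2 * Real.pi) ^ (-(n : ℝ) / 2)) ^ 2 = (2 * Real.pi) ^ (-(n : ℝ)) := by
    rw [← Real.rpow_natCast, ← Real.rpow_mul (by positivity)]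
    congr 1
    push_cast
    ring
  have h2 : ∀ j, ‖hat (u j) ξ‖ ^ 2 = (2 * Real.pi) ^ (-(n : ℝ)) *
      ‖𝓕 (u j : EuclideanSpace ℝ (Fin n) → ℂ) ((2 * Real.pi)⁻¹ • ξ)‖ ^ 2 := by
    intro j
    rw [hat, hξ j, norm_mul, mul_pow, Complex.norm_real, Real.norm_eq_abs, sq_abs, hc]
  simp only [h2, ← Finset.mul_sum]
  exact mul_le_mul_of_nonneg_left (sum_norm_fourier_sq_le hΩ hfin u hu hon _) (by positivity)

theorem integrable_norm_hat_sq {n : ℕ} (u : L2 n) :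
    Integrable (fun ξ => ‖hat u ξ‖ ^ 2) volume := by
  have h1 : Integrable (fun η => ‖(𝓕 u : L2 n) η‖ ^ 2) volume :=
    (Lp.memLp (𝓕 u : L2 n)).integrable_norm_pow (by norm_num)
  have h2 := (h1.comp_smul (R := (2 * Real.pi)⁻¹) (by positivity)).const_mul
    (((2 * Real.pi) ^ (-(n : ℝ) / 2)) ^ 2)
  refine h2.congr (Filter.Eventually.of_forall fun ξ => ?_)
  simp only [hat, norm_mul, mul_pow, Complex.norm_real, Real.norm_eq_abs, sq_abs]

/-- The squared normalisation `(2π)^{-n}` cancels the Jacobian of the rescaling of `ξ`, so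
Plancherel carries over. -/
theorem integral_norm_hat_sq {n : ℕ} (u : L2 n) :
    ∫ ξ, ‖hat u ξ‖ ^ 2 = ‖u‖ ^ 2 := by
  have hc : ((2 * Real.pi) ^ (-(n : ℝ) / 2)) ^ 2 = ((2 * Real.pi) ^ n)⁻¹ := by
    rw [← Real.rpow_natCast, ← Real.rpow_mul (by positivity), ← Real.rpow_natCast,
      ← Real.rpow_neg (by positivity)]
    congr 1
    push_cast
    ring
  have h1 : ∀ ξ, ‖hat u ξ‖ ^ 2 =
      ((2 * Real.pi) ^ n)⁻¹ * ‖(𝓕 u : L2 n) ((2 * Real.pi)⁻¹ • ξ)‖ ^ 2 := by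
    intro ξ
    simp only [hat, norm_mul, mul_pow, Complex.norm_real, Real.norm_eq_abs, sq_abs, hc]
  have h2 : ∫ η, ‖(𝓕 u : L2 n) η‖ ^ 2 = ‖u‖ ^ 2 := by
    rw [← Lp.norm_fourier_eq u]
    have h := L2.inner_def (𝕜 := ℂ) (𝓕 u : L2 n) (𝓕 u : L2 n)
    simp only [inner_self_eq_norm_sq_to_K] at h
    have h3 : ((∫ η, ‖(𝓕 u : L2 n) η‖ ^ 2 : ℝ) : ℂ) = ((‖(𝓕 u : L2 n)‖ ^ 2 : ℝ) : ℂ) := by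
      rw [← integral_complex_ofReal]
      push_cast
      exact h.symm
    exact_mod_cast h3
  simp only [h1]
  rw [integral_const_mul, Measure.integral_comp_smul volume
    (fun η => ‖(𝓕 u : L2 n) η‖ ^ 2) (2 * Real.pi)⁻¹, h2]
  simp only [finrank_euclideanSpace, Fintype.card_fin, inv_pow, inv_inv, smul_eq_mul]
  rw [abs_of_pos (by positivity)]
  field_simp

end FracLog

/-! ### Bathtub principle and integrals of the symbol over balls -/

namespace FracLog

/-- Integrate `(g - c) * (F - M * 1_B) ≥ 0`: both factors are nonpositive on `B` and nonnegative off
`B`. -/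
theorem bathtub_le_integral_mul {X : Type*} [MeasurableSpace X] {m : Measure X} {B : Set X}
    (hB : MeasurableSet B) (hBfin : m B ≠ ⊤) {g F : X → ℝ} {c M : ℝ} (hF0 : ∀ x, 0 ≤ F x)
    (hFM : ∀ᵐ x ∂m, F x ≤ M) (hF : Integrable F m) (hgF : Integrable (fun x => g x * F x) m)
    (hg : IntegrableOn g B m) (hin : ∀ x ∈ B, g x ≤ c) (hout : ∀ x ∉ B, c ≤ g x) :
    c * ∫ x, F x ∂m + M * (∫ x in B, g x ∂m - c * m.real B) ≤ ∫ x, g x * F x ∂m := by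
  have hc : IntegrableOn (fun _ => c) B m := integrableOn_const hBfin
  have h1 : ∫ x, B.indicator (fun x => M * (g x - c)) x ∂m ≤ ∫ x, (g x * F x - c * F x) ∂m := by
    refine integral_mono_ae ((integrable_indicator_iff hB).2 ((hg.sub hc).const_mul M))
      (hgF.sub (hF.const_mul c)) ?_
    filter_upwards [hFM] with x hx
    by_cases h : x ∈ B
    · simp only [Set.indicator_of_mem h]
      nlinarith [hin x h]
    · simp only [Set.indicator_of_notMem h]
      nlinarith [hout x h, hF0 x]
  rw [integral_indicator hB, integral_const_mul, integral_sub hg hc, setIntegral_const,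
    integral_sub hgF (hF.const_mul c), integral_const_mul, smul_eq_mul] at h1
  linarith

theorem intervalIntegrable_rpow_mul_log {a : ℝ} (ha : 1 ≤ a) (b c : ℝ) :
    IntervalIntegrable (fun r : ℝ => r ^ (a - 1) * Real.log r) volume b c :=
  intervalIntegral.intervalIntegrable_log'.continuousOn_mul
    (Real.continuous_rpow_const (by linarith)).continuousOn

theorem integral_rpow_mul_log {a R : ℝ} (ha : 1 ≤ a) (hR : 0 < R) :
    ∫ r in (0 : ℝ)..R, r ^ (a - 1) * Real.log r = R ^ a * (Real.log R / a - 1 / a ^ 2) := by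
  have ha0 : 0 < a := by linarith
  have hd : ∀ x : ℝ, 0 < x → HasDerivAt (fun r : ℝ => r ^ a * (Real.log r / a - 1 / a ^ 2))
      (x ^ (a - 1) * Real.log x) x := by
    intro x hx
    have h := (Real.hasDerivAt_rpow_const (x := x) (p := a) (Or.inl hx.ne')).mul
      (((Real.hasDerivAt_log hx.ne').div_const a).sub_const (1 / a ^ 2))
    refine h.congr_deriv ?_
    rw [Real.rpow_sub_one hx.ne']
    field_simp
    ring
  -- The antiderivative is differentiated only on `r > 0`. The value `fa := 0` is its limit at the
  -- origin, where `r ^ a * log r → 0`.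
  have h := intervalIntegral.integral_eq_sub_of_hasDerivAt_of_tendsto (fa := 0) hR
    (fun x hx => hd x hx.1) (intervalIntegrable_rpow_mul_log ha 0 R) ?_
    (((hd R hR).continuousAt.tendsto).mono_left nhdsWithin_le_nhds)
  · simpa using h
  · have h1 := (tendsto_log_mul_rpow_nhdsGT_zero ha0).div_const a
    have h2 : Filter.Tendsto (fun x : ℝ => x ^ a / a ^ 2) (nhdsWithin 0 (Set.Ioi 0))
        (nhds (0 / a ^ 2)) := by
      refine Filter.Tendsto.div_const ?_ _
      have := (Real.continuousAt_rpow_const 0 a (Or.inr ha0.le)).tendsto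
      rw [Real.zero_rpow ha0.ne'] at this
      exact this.mono_left nhdsWithin_le_nhds
    have h3 := h1.sub h2
    simp only [zero_div, sub_zero] at h3
    refine h3.congr fun x => ?_
    ring

/-- The profile of the radial function `symbol s`. -/
noncomputable def symbolProfile (s r : ℝ) : ℝ :=
  r ^ (2 * s) * Real.log (r ^ 2)

theorem pow_mul_symbolProfile {n : ℕ} (hn : 1 ≤ n) (s : ℝ) {r : ℝ} (hr : 0 < r) :
    r ^ (n - 1) * symbolProfile s r = 2 * (r ^ ((n : ℝ) + 2 * s - 1) * Real.log r) := by
  have h : r ^ ((n : ℝ) + 2 * s - 1) = r ^ (n - 1) * r ^ (2 * s) := by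
    rw [← Real.rpow_natCast, ← Real.rpow_add hr]
    congr 1
    push_cast [hn]
    ring
  rw [h, symbolProfile, Real.log_pow]
  push_cast
  ring

theorem integrableOn_ball_symbol {n : ℕ} {s : ℝ} (hn : 1 ≤ n) (hs : 0 < s) {R : ℝ} (hR : 0 < R) :
    IntegrableOn (symbol s) (Metric.ball (0 : EuclideanSpace ℝ (Fin n)) R) volume := by
  have : Nonempty (Fin n) := ⟨⟨0, hn⟩⟩
  have : Nontrivial (EuclideanSpace ℝ (Fin n)) := inferInstance
  have ha : 1 ≤ (n : ℝ) + 2 * s := by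
    have : (1 : ℝ) ≤ n := by exact_mod_cast hn
    linarith
  have h := integrableOn_fun_norm_addHaar (E := EuclideanSpace ℝ (Fin n)) volume
    (f := symbolProfile s) (r := R)
  refine h.2 ?_
  have h1 : IntegrableOn (fun r : ℝ => 2 * (r ^ ((n : ℝ) + 2 * s - 1) * Real.log r)) (Set.Ioo 0 R)
      volume := ((intervalIntegrable_iff_integrableOn_Ioo_of_le hR.le).1
    (intervalIntegrable_rpow_mul_log ha 0 R)).const_mul 2
  refine IntegrableOn.congr_fun h1 (fun r hr => ?_) measurableSet_Ioo
  simp only [finrank_euclideanSpace, Fintype.card_fin, smul_eq_mul]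
  exact (pow_mul_symbolProfile hn s hr.1).symm

theorem setIntegral_ball_symbol {n : ℕ} {s : ℝ} (hn : 1 ≤ n) (hs : 0 < s) {R : ℝ} (hR : 0 < R) :
    ∫ ξ in Metric.ball (0 : EuclideanSpace ℝ (Fin n)) R, symbol s ξ =
      n * unitBallVolume n * (2 * (R ^ ((n : ℝ) + 2 * s) *
        (Real.log R / ((n : ℝ) + 2 * s) - 1 / ((n : ℝ) + 2 * s) ^ 2))) := by
  have : Nonempty (Fin n) := ⟨⟨0, hn⟩⟩
  have : Nontrivial (EuclideanSpace ℝ (Fin n)) := inferInstance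
  have ha : 1 ≤ (n : ℝ) + 2 * s := by
    have : (1 : ℝ) ≤ n := by exact_mod_cast hn
    linarith
  have h1 : ∀ ξ : EuclideanSpace ℝ (Fin n), (Metric.ball 0 R).indicator (symbol s) ξ =
      (Set.Iio R).indicator (symbolProfile s) ‖ξ‖ := by
    intro ξ
    by_cases h : ‖ξ‖ < R <;> simp [Set.indicator, h, symbol, symbolProfile]
  rw [← integral_indicator Metric.isOpen_ball.measurableSet]
  simp only [h1]
  rw [integral_fun_norm_addHaar volume ((Set.Iio R).indicator (symbolProfile s))]
  simp only [finrank_euclideanSpace, Fintype.card_fin, smul_eq_mul, nsmul_eq_mul]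
  have h2 : ∫ y in Set.Ioi (0 : ℝ), y ^ (n - 1) * (Set.Iio R).indicator (symbolProfile s) y =
      ∫ y in (0 : ℝ)..R, 2 * (y ^ ((n : ℝ) + 2 * s - 1) * Real.log y) := by
    rw [intervalIntegral.integral_of_le hR.le, integral_Ioc_eq_integral_Ioo,
      ← Set.Ioi_inter_Iio, ← setIntegral_indicator measurableSet_Iio]
    refine setIntegral_congr_fun measurableSet_Ioi fun y hy => ?_
    by_cases h : y < R
    · simp [Set.indicator, h, pow_mul_symbolProfile hn s hy]
    · simp [Set.indicator, h]
  rw [h2, intervalIntegral.integral_const_mul, integral_rpow_mul_log ha hR, unitBallVolume]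
  ring

theorem symbolProfile_nonneg {s r : ℝ} (hr : 1 ≤ r) : 0 ≤ symbolProfile s r :=
  mul_nonneg (by positivity) (Real.log_nonneg (by nlinarith))

theorem symbolProfile_nonpos {s r : ℝ} (hr0 : 0 ≤ r) (hr : r ≤ 1) : symbolProfile s r ≤ 0 :=
  mul_nonpos_of_nonneg_of_nonpos (by positivity) (Real.log_nonpos (by positivity) (by nlinarith))

/-- Monotonicity fails on `[0, 1]`, but there the profile is nonpositive, hence below its value at
any `R ≥ 1`. On `[1, ∞)` it is a product of nonnegative increasing factors. -/
theorem symbolProfile_le_of_le {s r R : ℝ} (hs : 0 < s) (hr : 0 ≤ r) (hR : 1 ≤ R) (h : r ≤ R) :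
    symbolProfile s r ≤ symbolProfile s R := by
  rcases le_total r 1 with h1 | h1
  · exact (symbolProfile_nonpos hr h1).trans (symbolProfile_nonneg hR)
  · exact mul_le_mul (Real.rpow_le_rpow hr h (by linarith))
      (Real.log_le_log (by positivity) (by gcongr)) (Real.log_nonneg (by nlinarith)) (by positivity)

/-- The bathtub principle for the ball of radius `R` with level `symbolProfile s R`; `R ≥ 1` ensures
that the ball separates the values of the symbol at this level. The radius stays free so that it can
be adapted to the mass of `F`. -/
theorem integral_symbol_mul_ge {n : ℕ} {s : ℝ} (hn : 1 ≤ n) (hs : 0 < s) {R M : ℝ} (hR : 1 ≤ R)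
    {F : EuclideanSpace ℝ (Fin n) → ℝ} (hF0 : ∀ ξ, 0 ≤ F ξ) (hFM : ∀ᵐ ξ, F ξ ≤ M)
    (hF : Integrable F volume) (hgF : Integrable (fun ξ => symbol s ξ * F ξ) volume) :
    symbolProfile s R * ((∫ ξ, F ξ) - M * unitBallVolume n * R ^ n) +
        M * n * unitBallVolume n * (2 * (R ^ ((n : ℝ) + 2 * s) *
          (Real.log R / ((n : ℝ) + 2 * s) - 1 / ((n : ℝ) + 2 * s) ^ 2))) ≤
      ∫ ξ, symbol s ξ * F ξ := by
  have hR0 : 0 < R := by linarith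
  have h := bathtub_le_integral_mul (m := volume)
    (B := Metric.ball (0 : EuclideanSpace ℝ (Fin n)) R) (c := symbolProfile s R)
    Metric.isOpen_ball.measurableSet measure_ball_lt_top.ne hF0 hFM hF hgF
    (integrableOn_ball_symbol hn hs hR0)
    (fun ξ hξ => symbolProfile_le_of_le hs (norm_nonneg ξ) hR (mem_ball_zero_iff.1 hξ).le)
    (fun ξ hξ => symbolProfile_le_of_le hs hR0.le
      (hR.trans (not_lt.1 (mt mem_ball_zero_iff.2 hξ))) (not_lt.1 (mt mem_ball_zero_iff.2 hξ)))
  have hvol : volume.real (Metric.ball (0 : EuclideanSpace ℝ (Fin n)) R) =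
      R ^ n * unitBallVolume n := by
    rw [Measure.real, Measure.addHaar_ball_of_pos _ _ hR0, ENNReal.toReal_mul,
      ENNReal.toReal_ofReal (by positivity), finrank_euclideanSpace, Fintype.card_fin]
    rfl
  rw [setIntegral_ball_symbol hn hs hR0, hvol] at h
  linarith

end FracLog

/-! ### Orthonormal eigenfunctions -/

namespace FracLog

theorem exists_orthonormal_of_card_le_rank {E ι : Type*} [NormedAddCommGroup E]
    [InnerProductSpace ℂ E] [Fintype ι] (h : (Fintype.card ι : Cardinal) ≤ Module.rank ℂ E) :
    ∃ f : ι → E, Orthonormal ℂ f := by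
  obtain ⟨t, ht, hli⟩ := le_rank_iff_exists_linearIndependent_finset.1 h
  let e : Fin (Fintype.card ι) ≃ t := (finCongr ht.symm).trans t.equivFin.symm
  exact ⟨_, (InnerProductSpace.gramSchmidtNormed_orthonormal
    (hli.comp e e.injective)).comp _ (Fintype.equivFin ι).injective⟩

theorem star_form {n : ℕ} {s : ℝ} (u v : energySpace n s) : star (form u v) = form v u := by
  unfold form
  rw [Complex.star_def, ← integral_conj]
  congr 1
  ext ξ
  simp only [map_mul, Complex.conj_ofReal, Complex.conj_conj]
  ring

theorem form_self {n : ℕ} {s : ℝ} (u : energySpace n s) :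
    form u u = ((∫ ξ, symbol s ξ * ‖hat (u : L2 n) ξ‖ ^ 2 : ℝ) : ℂ) := by
  rw [form, ← integral_complex_ofReal]
  congr 1
  ext ξ
  rw [Complex.star_def, Complex.mul_conj, Complex.normSq_eq_norm_sq]
  push_cast
  ring

/-- The form is Hermitian because the symbol is real, so testing each eigenfunction against the
other gives `(μ - ν) ⟨u, v⟩ = 0`. -/
theorem inner_eq_zero_of_mem_eigenspace {n : ℕ} {s : ℝ} {V : Submodule ℂ (energySpace n s)}
    {μ ν : ℝ} (hμν : μ ≠ ν) {u v : energySpace n s} (hu : u ∈ eigenspace V μ)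
    (hv : v ∈ eigenspace V ν) : inner ℂ (u : L2 n) (v : L2 n) = 0 := by
  have h1 := hu.2 v hv.1
  have h2 := hv.2 u hu.1
  rw [← star_form, h1, Complex.star_def, map_mul, Complex.conj_ofReal,
    inner_conj_symm] at h2
  have h3 : ((μ : ℂ) - ν) * inner ℂ (u : L2 n) (v : L2 n) = 0 := by rw [sub_mul, h2, sub_self]
  rcases mul_eq_zero.1 h3 with h | h
  · exact absurd (by exact_mod_cast sub_eq_zero.1 h) hμν
  · exact h

/-- The indices below `k` with a given value `μ` number at most the dimension of its eigenspace, so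
Gram–Schmidt supplies enough vectors there. Different values give orthogonal eigenspaces, and no
completeness of the eigenfunctions is needed. -/
theorem exists_orthonormal_eigenfunctions {n : ℕ} {s : ℝ} {V : Submodule ℂ (energySpace n s)}
    {lam : ℕ → ℝ} (hlam : IsEigenvalueSequence V lam) (k : ℕ) :
    ∃ u : Fin k → energySpace n s, Orthonormal ℂ (fun j => (u j : L2 n)) ∧
      ∀ j : Fin k, u j ∈ eigenspace V (lam j) := by
  classical
  -- The eigenspaces are moved into `L2 n`, where orthonormality is wanted; the inclusion is
  -- injective, so ranks are unchanged.
  let W : ℝ → Submodule ℂ (L2 n) := fun μ => (eigenspace V μ).map (energySpace n s).subtype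
  have key : ∀ μ, ∃ f : {j : Fin k // lam (j : ℕ) = μ} → W μ, Orthonormal ℂ f := by
    intro μ
    apply exists_orthonormal_of_card_le_rank
    have hr : Module.rank ℂ (W μ) = Module.rank ℂ (eigenspace V μ) :=
      (LinearEquiv.rank_eq (Submodule.equivMapOfInjective _
        (Submodule.injective_subtype _) (eigenspace V μ))).symm
    rw [hr]
    have h1 : (Fintype.card {j : Fin k // lam (j : ℕ) = μ} : ℕ∞) ≤
        Cardinal.toENat (Module.rank ℂ (eigenspace V μ)) := by
      rw [← hlam.multiplicity μ, ← ENat.card_coe_set_eq, ← ENat.card_eq_coe_fintype_card]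
      refine ENat.card_le_card_of_injective
        (f := fun j => (⟨(j.1 : ℕ), j.2⟩ : {j : ℕ | lam j = μ})) ?_
      intro a b hab
      exact Subtype.ext (Fin.ext (congrArg Subtype.val hab))
    simpa using h1
  choose f hf using key
  have hmem : ∀ μ (w : W μ), ∃ u ∈ eigenspace V μ, (u : L2 n) = w := by
    rintro μ ⟨w, u, hu, rfl⟩
    exact ⟨u, hu, rfl⟩
  choose g hg hg' using hmem
  refine ⟨fun j => g (lam j) (f (lam j) ⟨j, rfl⟩), ⟨fun j => ?_, fun i j hij => ?_⟩,
    fun j => hg _ _⟩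
  · simp only [hg']
    exact (hf (lam j)).1 ⟨j, rfl⟩
  · by_cases h : lam i = lam j
    -- The vectors for `i` and `j` lie in families indexed by `lam i` and `lam j`; `h1` transports
    -- one to the other so that orthonormality within a single family applies.
    · have h1 : ∀ μ (hj : lam j = μ), ((f (lam j) ⟨j, rfl⟩ : W (lam j)) : L2 n) =
          (f μ ⟨j, hj⟩ : W μ) := by
        rintro μ rfl
        rfl
      have h2 := (hf (lam i)).2 (i := ⟨i, rfl⟩) (j := ⟨j, h.symm⟩)
        (fun h => hij (congrArg Subtype.val h))
      simp only [hg']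
      rw [h1 (lam i) h.symm]
      exact h2
    · exact inner_eq_zero_of_mem_eigenspace h (hg _ _) (hg _ _)

end FracLog

/-! ### Lower bounds for the eigenvalue sum -/

namespace FracLog

theorem sum_eigenvalues_ge {n : ℕ} {s : ℝ} (hn : 1 ≤ n) (hs : 0 < s)
    {Ω : Set (EuclideanSpace ℝ (Fin n))} (hΩ : MeasurableSet Ω) (hfin : volume Ω ≠ ⊤)
    {V : Submodule ℂ (energySpace n s)} (hV : V ≤ vanishingSpace s Ω) {lam : ℕ → ℝ}
    (hlam : IsEigenvalueSequence V lam) (k : ℕ) {R M : ℝ} (hR : 1 ≤ R)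
    (hM : M = (2 * Real.pi) ^ (-(n : ℝ)) * volume.real Ω) :
    symbolProfile s R * (k - M * unitBallVolume n * R ^ n) +
        M * n * unitBallVolume n * (2 * (R ^ ((n : ℝ) + 2 * s) *
          (Real.log R / ((n : ℝ) + 2 * s) - 1 / ((n : ℝ) + 2 * s) ^ 2))) ≤
      ∑ j ∈ Finset.range k, lam j := by
  obtain ⟨u, hon, hu⟩ := exists_orthonormal_eigenfunctions hlam k
  have hvan : ∀ j, ∀ᵐ x ∂(volume : Measure (EuclideanSpace ℝ (Fin n))),
      x ∉ Ω → (u j : L2 n) x = 0 := fun j => hV (hu j).1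
  have hint : ∀ j, Integrable (fun ξ => symbol s ξ * ‖hat (u j : L2 n) ξ‖ ^ 2) volume := by
    intro j
    have h : Integrable (fun ξ => |symbol s ξ| * ‖hat (u j : L2 n) ξ‖ ^ 2) volume := (u j).2
    refine Integrable.congr' h ((measurable_symbol s).aestronglyMeasurable.mul
      ((aestronglyMeasurable_hat _).norm.pow 2)) (Filter.Eventually.of_forall fun ξ => ?_)
    simp
  have hlamj : ∀ j : Fin k, ∫ ξ, symbol s ξ * ‖hat (u j : L2 n) ξ‖ ^ 2 = lam j := by
    intro j
    -- The eigenvalue equation is tested against the normalised eigenfunction itself.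
    have h1 := (hu j).2 (u j) (hu j).1
    rw [form_self, inner_self_eq_norm_sq_to_K, hon.1 j] at h1
    have h2 : ((∫ ξ, symbol s ξ * ‖hat (u j : L2 n) ξ‖ ^ 2 : ℝ) : ℂ) = (lam j : ℂ) := by
      simpa using h1
    exact_mod_cast h2
  have h := integral_symbol_mul_ge hn hs (M := M) hR
    (F := fun ξ => ∑ j, ‖hat (u j : L2 n) ξ‖ ^ 2)
    (fun ξ => by positivity) (hM ▸ sum_norm_hat_sq_le hΩ hfin _ hvan hon)
    (integrable_finsetSum _ fun j _ => integrable_norm_hat_sq _)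
    (by simpa only [Finset.mul_sum] using integrable_finsetSum _ fun j _ => hint j)
  simp only [Finset.mul_sum] at h
  rw [integral_finsetSum _ fun j _ => integrable_norm_hat_sq _,
    integral_finsetSum _ fun j _ => hint j] at h
  simp only [integral_norm_hat_sq, hlamj, hon.1] at h
  rw [← Fin.sum_univ_eq_sum_range]
  simpa using h

theorem unitBallVolume_pos (n : ℕ) : 0 < unitBallVolume n :=
  ENNReal.toReal_pos (Metric.measure_ball_pos _ _ one_pos).ne' measure_ball_lt_top.ne

end FracLog

theorem theorem2p5 (n : ℕ) (hn : 1 ≤ n) (s : ℝ) (hs : 0 < s)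
    (Ω : Set (EuclideanSpace ℝ (Fin n)))
    (hΩ_open : IsOpen Ω) (hΩ_conn : IsConnected Ω) (hΩ_bdd : Bornology.IsBounded Ω)
    (V : Submodule ℂ (FracLog.energySpace n s))
    (hV : V = FracLog.vanishingSpace s Ω ∨ V = FracLog.testClosure s Ω)
    (lam : ℕ → ℝ) (hlam : FracLog.IsEigenvalueSequence V lam)
    (k : ℕ) (hk : 1 ≤ k) :
    -((2 * Real.pi) ^ (-(n : ℝ)) *
        (2 * n * FracLog.unitBallVolume n / ((n : ℝ) + 2 * s) ^ 2) * volume.real Ω)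
      ≤ ∑ j ∈ Finset.range k, lam j ∧
    ((2 * Real.pi) ^ (-(n : ℝ)) * FracLog.unitBallVolume n * volume.real Ω ≤ (k : ℝ) →
      2 / ((n : ℝ) + 2 * s) * (2 * Real.pi) ^ (2 * s) *
          (FracLog.unitBallVolume n * volume.real Ω) ^ (-(2 * s) / (n : ℝ)) *
          (k : ℝ) ^ (1 + 2 * s / (n : ℝ)) *
          (Real.log ((2 * Real.pi) ^ n * (k : ℝ) / (FracLog.unitBallVolume n * volume.real Ω))
            - (n : ℝ) / ((n : ℝ) + 2 * s))
        ≤ ∑ j ∈ Finset.range k, lam j) := by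
  have hVle : V ≤ FracLog.vanishingSpace s Ω := by
    rcases hV with rfl | rfl
    · exact le_rfl
    · exact fun u hu => hu.1
  have hfin : volume Ω ≠ ⊤ := hΩ_bdd.measure_lt_top.ne
  have hvol : 0 < volume.real Ω :=
    ENNReal.toReal_pos (hΩ_open.measure_pos volume hΩ_conn.nonempty).ne' hfin
  have hω := FracLog.unitBallVolume_pos n
  have hn0 : (0 : ℝ) < n := by exact_mod_cast hn
  have hk0 : (0 : ℝ) < k := by exact_mod_cast hk
  have hgen := fun R (hR : 1 ≤ R) => FracLog.sum_eigenvalues_ge hn hs hΩ_open.measurableSet hfin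
    hVle hlam k (R := R) hR rfl
  constructor
  -- At `R = 1` both logarithms vanish, leaving only the term with `-1 / (n + 2s)^2`.
  · refine le_trans (le_of_eq ?_) (hgen 1 le_rfl)
    simp [FracLog.symbolProfile]
    ring
  · intro hkω
    set W := FracLog.unitBallVolume n * volume.real Ω with hW
    have hW0 : 0 < W := by positivity
    have hpn : (2 * Real.pi) ^ (-(n : ℝ)) = ((2 * Real.pi) ^ n)⁻¹ := by
      rw [Real.rpow_neg (by positivity), Real.rpow_natCast]
    set Q := (2 * Real.pi) ^ n * (k : ℝ) / W with hQ
    have hQ0 : 0 < Q := by positivity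
    -- The lower bound on `k` is exactly what makes the radius `Q ^ (1 / n)` admissible.
    have hQ1 : 1 ≤ Q := by
      rw [hpn, mul_assoc, ← hW, inv_mul_le_iff₀ (by positivity)] at hkω
      rwa [hQ, le_div_iff₀ hW0, one_mul]
    set R := Q ^ (1 / (n : ℝ)) with hRdef
    have hR1 : 1 ≤ R := Real.one_le_rpow hQ1 (by positivity)
    have hR0 : 0 < R := by linarith
    have hRn : R ^ n = Q := by
      rw [hRdef, ← Real.rpow_natCast, ← Real.rpow_mul hQ0.le, one_div_mul_cancel hn0.ne',
        Real.rpow_one]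
    -- The choice of `Q = R ^ n` fills the ball at height `M` with total mass `k`, so the level term
    -- in `hgen` vanishes.
    have hMk : (2 * Real.pi) ^ (-(n : ℝ)) * volume.real Ω * FracLog.unitBallVolume n * Q = k := by
      rw [hpn, mul_assoc _ (volume.real Ω), mul_comm (volume.real Ω), ← hW, hQ]
      field_simp
    have hlog : Real.log Q = n * Real.log R := by rw [← hRn, Real.log_pow]
    have hR2s : R ^ (2 * s) = (2 * Real.pi) ^ (2 * s) * W ^ (-(2 * s) / (n : ℝ)) *
        (k : ℝ) ^ (2 * s / (n : ℝ)) := by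
      rw [hRdef, ← Real.rpow_mul hQ0.le, hQ, Real.div_rpow (by positivity) hW0.le,
        Real.mul_rpow (by positivity) hk0.le, ← Real.rpow_natCast, ← Real.rpow_mul (by positivity),
        neg_div, Real.rpow_neg hW0.le, one_div_mul_eq_div,
        mul_div_cancel₀ (2 * s) hn0.ne']
      ring
    have hRa : R ^ ((n : ℝ) + 2 * s) = Q * R ^ (2 * s) := by
      rw [Real.rpow_add hR0, Real.rpow_natCast, hRn]
    have h := hgen R hR1
    rw [hRn, hMk, sub_self, mul_zero, zero_add, hRa] at h
    refine le_trans (le_of_eq ?_) h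
    rw [hlog, Real.rpow_add hk0, Real.rpow_one]
    calc _ = 2 / ((n : ℝ) + 2 * s) * k * R ^ (2 * s) *
          (n * Real.log R - n / ((n : ℝ) + 2 * s)) := by rw [hR2s]; ring
      _ = ((2 * Real.pi) ^ (-(n : ℝ)) * volume.real Ω * FracLog.unitBallVolume n * Q) * n *
          (2 * (R ^ (2 * s) * (Real.log R / ((n : ℝ) + 2 * s) - 1 / ((n : ℝ) + 2 * s) ^ 2))) := by
          rw [hMk]
          field_simp
      _ = _ := by ring
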